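/- Let $\lambda>0$ be a real number and let $G=\{(m,n\lambda): m,n\in\mathbb Z\}$ be the lattice generated by the rectangle $1\times\lambda$. Call two points of the plane *simply equivalent* if one is carried to the other by a translation by a vector of $G$, and *complexly equivalent* if one is carried to the other by a finite composition of central symmetries about points of $G$. Squares are closed, nondegenerate, and may have any position, size and orientation. A *periodic tiling of the plane by squares with periods $(1,0)$ and $(0,\lambda)$* is a finite set $\Gamma$ of squares with pairwise disjoint interiors such that every point of the plane is simply equivalent to some point of the union of the squares of $\Gamma$, and no two distinct points of the interior of this union are simply equivalent. A *covering of the $1\times\lambda$ rectangle by squares on both sides in one layer* is defined in the same way, with "complexly equivalent" in place of "simply equivalent". **Theorem.** (a) If there is a periodic tiling of the plane by squares with periods $(1,0)$ and $(0,\lambda)$, then $\lambda=p+\sqrt{q^2-r^2}$ or $\lambda=p-\sqrt{q^2-r^2}$ for some rational numbers $p\ge q\ge r\ge 0$. (b) If the $1\times\lambda$ rectangle can be covered by finitely many squares on both sides in one layer, then $\lambda=p+\sqrt{q^2-r^2}$ or $\lambda=p-\sqrt{q^2-r^2}$ for some rational numbers $p\ge q\ge r\ge 0$. -/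

import Mathlib

namespace SquareTiling

/-- The Euclidean plane. -/
abbrev Plane : Type := EuclideanSpace ℝ (Fin 2)

/-- A closed nondegenerate square in the plane, of any size, in any position and orientation:
`p` is a vertex, and `u`, `v` are the two sides issuing from it. -/
def IsClosedSquare (Q : Set Plane) : Prop :=
  ∃ p u v : Plane, u ≠ 0 ∧ ‖u‖ = ‖v‖ ∧ inner ℝ u v = 0 ∧
    Q = {x | ∃ s ∈ Set.Icc (0 : ℝ) 1, ∃ t ∈ Set.Icc (0 : ℝ) 1, x = p + s • u + t • v}

/-- The lattice generated by the rectangle `1 × lam`, i.e. by the vectors `(1, 0)` and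
`(0, lam)`. -/
def lattice (lam : ℝ) : Set Plane :=
  {g | ∃ m n : ℤ, g = !₂[(m : ℝ), (n : ℝ) * lam]}

/-- Two points are simply equivalent if a translation by a lattice vector carries one to the
other. -/
def SimplyEquivalent (lam : ℝ) (x y : Plane) : Prop :=
  ∃ g ∈ lattice lam, x + g = y

/-- Two points are complexly equivalent if a composition of central symmetries about lattice
points carries one to the other. The submonoid closure consists of all finite compositions. -/
def ComplexlyEquivalent (lam : ℝ) (x y : Plane) : Prop :=
  ∃ σ ∈ Submonoid.closure {τ : Equiv.Perm Plane | ∃ g ∈ lattice lam, τ = Equiv.pointReflection g},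
    σ x = y

/-- `Γ` is a finite set of squares with pairwise disjoint interiors, such that every point of the
plane is equivalent (in the sense of `R`) to a point of the union of the squares, and no two
distinct points of the interior of that union are equivalent. -/
structure IsSquareCoverMod (R : Plane → Plane → Prop) (Γ : Set (Set Plane)) : Prop where
  finite : Γ.Finite
  isClosedSquare : ∀ Q ∈ Γ, IsClosedSquare Q
  disjoint_interiors : Γ.Pairwise fun Q Q' => Disjoint (interior Q) (interior Q')
  covers : ∀ x : Plane, ∃ y ∈ ⋃₀ Γ, R x y
  no_overlap : ∀ x ∈ interior (⋃₀ Γ), ∀ y ∈ interior (⋃₀ Γ), R x y → x = y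

/-- A periodic tiling of the plane by squares with periods `(1, 0)` and `(0, lam)`. -/
def IsPeriodicSquareTiling (lam : ℝ) (Γ : Set (Set Plane)) : Prop :=
  IsSquareCoverMod (SimplyEquivalent lam) Γ

/-- A covering of the `1 × lam` rectangle on both sides, in one layer, by squares. -/
def IsTwoSidedSquareCovering (lam : ℝ) (Γ : Set (Set Plane)) : Prop :=
  IsSquareCoverMod (ComplexlyEquivalent lam) Γ

end SquareTiling

namespace SquareTiling

/-! The proof is a Dehn-type argument with a generalized area. For `ℚ`-linear maps f, g on the
reals, assign the number f(width) g(height) to a box with sides in two fixed perpendicular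
directions. This quantity is additive under cutting and invariant under translation, so two finite
families of such boxes whose translates by one lattice partition the plane have equal totals
(`sum_box_eq_sum_box`).

To apply this, all squares of a lattice tiling must be parallel. Non-parallel squares with disjoint
interiors share at most one point, and a countable set cannot disconnect the plane
(`isFramedSquare_of_tiling`). In the directions of the squares, the lattice of the a × aλ rectangle
is also the lattice of a tiling by an L-shaped hexagon cut into boxes ac × λac and λas × as, where
(c, s) is a unit vector (`hexagon_partition`). Hence the sum of f(w) g(w) over the sides w of the
squares equals f(ac) g(λac) + f(λas) g(as).

The left side is symmetric in f and g, and nonnegative for f = g. If λ is irrational, symmetry puts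
s and λs in the rational span of c and λc, which makes λ quadratic. Positivity, tested on a map that
acts as Galois conjugation, makes the conjugate of λ nonnegative (`isTwoRootForm_of_form`), and this
gives the required form.

A two-sided covering reduces to this case: its squares and their images under x ↦ -x tile the plane
modulo the doubled lattice, whose rectangle has the same ratio of sides. -/

/-- The conclusion of the theorem: `lam = p ± √(q² - r²)` with rational `p ≥ q ≥ r ≥ 0`. -/
def IsTwoRootForm (lam : ℝ) : Prop :=
  ∃ p q r : ℚ, p ≥ q ∧ q ≥ r ∧ r ≥ 0 ∧
    (lam = (p : ℝ) + √((q : ℝ) ^ 2 - (r : ℝ) ^ 2) ∨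
      lam = (p : ℝ) - √((q : ℝ) ^ 2 - (r : ℝ) ^ 2))

/-! ### Arithmetic: rationals and quadratic irrationals with nonnegative conjugate -/

theorem isTwoRootForm_ratCast {p : ℚ} (hp : 0 ≤ p) : IsTwoRootForm p :=
  ⟨p, 0, 0, hp, le_rfl, le_rfl, Or.inl (by simp)⟩

theorem isTwoRootForm_of_quadratic {lam : ℝ} (hlam : 0 < lam) {A C : ℚ}
    (h : lam ^ 2 = A * lam + C) (hconj : 0 ≤ (A : ℝ) - lam) : IsTwoRootForm lam := by
  have hA : (0 : ℝ) < A := by linarith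
  have hA' : (0 : ℚ) < A := by exact_mod_cast hA
  set p : ℚ := A / 2 with hp
  have hp0 : 0 < p := by positivity
  set D : ℚ := p ^ 2 + C with hD
  have hDR : (D : ℝ) = (lam - p) ^ 2 := by
    rw [hD, hp]; push_cast; linear_combination (-1 : ℝ) * h
  have hD0 : 0 ≤ D := by
    have : (0 : ℝ) ≤ D := by rw [hDR]; positivity
    exact_mod_cast this
  have hDp : D ≤ p ^ 2 := by
    have : (D : ℝ) ≤ (p : ℝ) ^ 2 := by
      rw [hDR, hp]; push_cast; nlinarith
    exact_mod_cast this
  have hdiv : D / p ≤ p := by rw [div_le_iff₀ hp0]; nlinarith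
  have hdiv0 : 0 ≤ D / p := by positivity
  -- Here q and r solve q + r = p and q - r = D / p, so q² - r² = D.
  refine ⟨p, (p + D / p) / 2, (p - D / p) / 2, by linarith, by linarith, by linarith, ?_⟩
  have hq : (((p + D / p) / 2 : ℚ) : ℝ) ^ 2 - (((p - D / p) / 2 : ℚ) : ℝ) ^ 2 = (lam - p) ^ 2 := by
    have : ((p + D / p) / 2) ^ 2 - ((p - D / p) / 2) ^ 2 = D := by field_simp; ring
    rw [← hDR]; exact_mod_cast this
  rw [hq, Real.sqrt_sq_eq_abs]
  rcases abs_choice (lam - p) with h | h <;> rw [h]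
  · left; ring
  · right; ring

/-- Real numbers that are linearly independent over `ℚ` can be given arbitrary images by a
`ℚ`-linear map. -/
theorem exists_linearMap_of_linearIndependent {n : ℕ} {x : Fin n → ℝ}
    (hx : LinearIndependent ℚ x) (y : Fin n → ℝ) : ∃ f : ℝ →ₗ[ℚ] ℝ, ∀ i, f (x i) = y i := by
  obtain ⟨f, hf⟩ := LinearMap.exists_extend ((Module.Basis.span hx).constr ℚ y)
  refine ⟨f, fun i => ?_⟩
  have := LinearMap.congr_fun hf (Module.Basis.span hx i)
  rw [Module.Basis.constr_basis] at this
  rw [← this]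
  simp [Module.Basis.span_apply]

/-- If the bilinear form `f c * g (lam * c) + f (lam * s) * g s` on `ℚ`-linear maps is symmetric
and positive semidefinite, then `lam` is rational or a quadratic irrational with nonnegative
conjugate. -/
theorem isTwoRootForm_of_form {lam c s : ℝ} (hlam : 0 < lam) (hc : c ≠ 0)
    (hsymm : ∀ f g : ℝ →ₗ[ℚ] ℝ, f c * g (lam * c) + f (lam * s) * g s =
      g c * f (lam * c) + g (lam * s) * f s)
    (hpos : ∀ f : ℝ →ₗ[ℚ] ℝ, 0 ≤ f c * f (lam * c) + f (lam * s) * f s) :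
    IsTwoRootForm lam := by
  by_cases hirr : Irrational lam
  swap
  · obtain ⟨p, rfl⟩ : ∃ p : ℚ, (p : ℝ) = lam := by simpa [Irrational] using hirr
    exact isTwoRootForm_ratCast (by exact_mod_cast hlam.le)
  have zero_of {a b : ℚ} (h : (a : ℝ) + b * lam = 0) : a = 0 ∧ b = 0 := by
    have hb : b = 0 := by
      by_contra hb
      refine hirr ⟨-a / b, ?_⟩
      have : (b : ℝ) ≠ 0 := by exact_mod_cast hb
      push_cast; field_simp; linarith
    subst hb
    exact ⟨by simpa using h, rfl⟩
  have hind : LinearIndependent ℚ ![c, lam * c] := by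
    rw [LinearIndependent.pair_iff]
    intro a b h
    apply zero_of
    rw [Rat.smul_def, Rat.smul_def] at h
    apply mul_right_cancel₀ hc
    linarith
  -- If z were independent of c and λc, maps f and g vanishing at z could have values (1, 0) and (0,
  -- 1) on (c, λc), against the hypothesis. For z = s and z = λs that hypothesis is `hsymm` with its
  -- second terms killed.
  have key : ∀ z : ℝ, (∀ f g : ℝ →ₗ[ℚ] ℝ, f z = 0 → g z = 0 →
      f c * g (lam * c) = g c * f (lam * c)) → ∃ a b : ℚ, z = (a + b * lam) * c := by
    intro z hz
    by_contra hcon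
    have h3 : LinearIndependent ℚ ![z, c, lam * c] := by
      refine linearIndependent_finCons.2 ?_
      refine ⟨hind, fun hmem => hcon ?_⟩
      rw [Matrix.range_cons, Matrix.range_cons, Matrix.range_empty, Set.union_empty,
        Set.singleton_union, Submodule.mem_span_pair] at hmem
      obtain ⟨a, b, h⟩ := hmem
      exact ⟨a, b, by rw [← h, Rat.smul_def, Rat.smul_def]; ring⟩
    obtain ⟨f, hf⟩ := exists_linearMap_of_linearIndependent h3 ![0, 1, 0]
    obtain ⟨g, hg⟩ := exists_linearMap_of_linearIndependent h3 ![0, 0, 1]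
    have f0 := hf 0; have f1 := hf 1; have f2 := hf 2
    have g0 := hg 0; have g1 := hg 1; have g2 := hg 2
    simp at f0 f1 f2 g0 g1 g2
    have := hz f g f0 g0
    rw [f1, f2, g1, g2] at this
    norm_num at this
  obtain ⟨α, β, hs⟩ := key s fun f g hf hg => by
    have := hsymm f g; rw [hf, hg] at this; simpa using this
  obtain ⟨γ, δ, hls⟩ := key (lam * s) fun f g hf hg => by
    have := hsymm f g; rw [hf, hg] at this; simpa using this
  have hrel : (α + β * lam) * lam = γ + δ * lam := by
    apply mul_right_cancel₀ hc
    rw [← hls, hs]; ring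
  have hval : ∀ (f : ℝ →ₗ[ℚ] ℝ) (a b : ℚ), f ((a + b * lam) * c) = a * f c + b * f (lam * c) := by
    intro f a b
    have : (a + b * lam) * c = a • c + b • (lam * c) := by
      rw [Rat.smul_def, Rat.smul_def]; ring
    rw [this, map_add, map_smul, map_smul, Rat.smul_def, Rat.smul_def]
  -- The form is evaluated at a map with c ↦ 1 and λc ↦ y; y is free because λ is irrational.
  have hform : ∀ y : ℝ, 0 ≤ y + (γ + δ * y) * (α + β * y) := by
    intro y
    obtain ⟨f, hf⟩ := exists_linearMap_of_linearIndependent hind ![1, y]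
    have f0 := hf 0; have f1 := hf 1
    simp at f0 f1
    have := hpos f
    rw [hls, hs, hval, hval, f0, f1] at this
    simpa using this
  by_cases hβ : β = 0
  · subst hβ
    obtain ⟨h1, h2⟩ := zero_of (a := γ) (b := δ - α) (by push_cast; push_cast at hrel; linarith)
    have hδ : δ = α := by linarith
    -- In this case the form is y (1 + α²), which is negative at y = -1.
    have := hform (-1)
    rw [h1, hδ] at this
    push_cast at this
    nlinarith [sq_nonneg (α : ℝ)]
  · have hβ' : (β : ℝ) ≠ 0 := by exact_mod_cast hβ
    refine isTwoRootForm_of_quadratic hlam (A := (δ - α) / β) (C := γ / β) ?_ ?_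
    · push_cast; field_simp; linarith
    · set A : ℚ := (δ - α) / β with hA
      -- This y is the conjugate of λ. At it the form factors as y times a positive number.
      set y : ℝ := A - lam with hy
      have hδ : (δ : ℝ) = α + β * A := by rw [hA]; push_cast; field_simp; ring
      have hγ : (γ : ℝ) = β * lam * (lam - A) := by
        rw [hδ] at hrel; linarith
      have h := hform y
      have h2 : y + (γ + δ * y) * (α + β * y) = y * (1 + (α + β * y) ^ 2) := by
        rw [hγ, hδ, hy]; ring
      rw [h2] at h
      exact nonneg_of_mul_nonneg_left h (by positivity)

/-! ### Generalized area of half-open boxes -/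

/-- The indicator function of the ray `(-∞, t]`. -/
noncomputable def rayIndicator (t : ℝ) : ℝ → ℝ := fun x => if x ≤ t then 1 else 0

/-- At the largest endpoint of a finite set of rays only the ray with that endpoint is nonzero, so
its coefficient vanishes. -/
theorem linearIndependent_rayIndicator : LinearIndependent ℝ rayIndicator := by
  rw [linearIndependent_iff']
  intro s
  induction s using Finset.induction_on_max with
  | empty => simp
  | insert a s hmax ih =>
    intro g hg
    have ha : a ∉ s := fun h => lt_irrefl _ (hmax a h)
    rw [Finset.sum_insert ha] at hg
    have h0 : g a = 0 := by
      have h1 := congrFun hg a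
      have h2 : ∑ i ∈ s, g i * rayIndicator i a = 0 :=
        Finset.sum_eq_zero fun i hi => by simp [rayIndicator, (hmax i hi).not_ge]
      simp only [Pi.add_apply, Pi.smul_apply, Finset.sum_apply, smul_eq_mul, h2] at h1
      simpa [rayIndicator] using h1
    intro i hi
    rcases Finset.mem_insert.1 hi with rfl | hi
    · exact h0
    · exact ih g (by simpa [h0] using hg) i hi

/-- The indicator function of `(p, q]`. -/
noncomputable def iocIndicator (p q : ℝ) : ℝ → ℝ := (Set.Ioc p q).indicator 1

/-- By independence, Φ may take the value f(t) on the ray ending at t, and it then extends to all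
functions. Additivity of f turns a difference of rays into f(q - p); the maximum covers empty
intervals. -/
theorem exists_functional_ioc (f : ℝ →ₗ[ℚ] ℝ) : ∃ Φ : (ℝ → ℝ) →ₗ[ℝ] ℝ,
    ∀ p q, Φ (iocIndicator p q) = f (max (q - p) 0) := by
  obtain ⟨Φ, hΦ⟩ := LinearMap.exists_extend
    ((Module.Basis.span linearIndependent_rayIndicator).constr ℝ (f : ℝ → ℝ))
  have key (t : ℝ) : Φ (rayIndicator t) = f t := by
    have := LinearMap.congr_fun hΦ (Module.Basis.span linearIndependent_rayIndicator t)
    rw [Module.Basis.constr_basis] at this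
    rw [← this]
    simp [Module.Basis.span_apply]
  refine ⟨Φ, fun p q => ?_⟩
  rcases le_total p q with h | h
  · have : iocIndicator p q = rayIndicator q - rayIndicator p := by
      ext x
      simp only [iocIndicator, rayIndicator, Set.indicator, Set.mem_Ioc, Pi.one_apply, Pi.sub_apply]
      split_ifs <;> grind
    rw [this, map_sub, key, key, max_eq_left (by linarith), map_sub]
  · have : iocIndicator p q = 0 := by
      rw [iocIndicator, Set.Ioc_eq_empty h.not_gt]
      exact Set.indicator_empty _
    rw [this, max_eq_right (by linarith), map_zero, map_zero]

/-- A half-open box with lower left corner `(a, b)`, width `w` and height `h`. -/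
def iocBox (a b w h : ℝ) : Set (ℝ × ℝ) := Set.Ioc a (a + w) ×ˢ Set.Ioc b (b + h)

/-- A tensor product: Ψ is applied in the second variable for each fixed x, then Φ to the resulting
function of x. -/
theorem exists_functional_box (f g : ℝ →ₗ[ℚ] ℝ) : ∃ M : (ℝ × ℝ → ℝ) →ₗ[ℝ] ℝ,
    ∀ p q p' q', M ((Set.Ioc p q ×ˢ Set.Ioc p' q').indicator 1) =
      f (max (q - p) 0) * g (max (q' - p') 0) := by
  obtain ⟨Φ, hΦ⟩ := exists_functional_ioc f
  obtain ⟨Ψ, hΨ⟩ := exists_functional_ioc g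
  refine ⟨Φ ∘ₗ LinearMap.pi fun x => Ψ ∘ₗ LinearMap.funLeft ℝ ℝ fun y => (x, y), ?_⟩
  intro p q p' q'
  rw [mul_comm, ← hΦ, ← hΨ, ← smul_eq_mul, ← map_smul, LinearMap.comp_apply]
  congr 1
  ext x
  have : (LinearMap.funLeft ℝ ℝ fun y => (x, y))
      ((Set.Ioc p q ×ˢ Set.Ioc p' q').indicator 1) =
      iocIndicator p q x • iocIndicator p' q' := by
    ext y
    simp only [LinearMap.funLeft_apply, iocIndicator, Set.indicator, Set.mem_prod, Pi.one_apply,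
      Pi.smul_apply, smul_eq_mul]
    split_ifs <;> simp_all
  rw [LinearMap.pi_apply, LinearMap.comp_apply, this, map_smul, Pi.smul_apply, smul_eq_mul,
    smul_eq_mul, mul_comm]

theorem indicator_eq_sum_inter {α β γ : Type*} [Fintype β] (S : Finset γ) (A : Set α)
    (F : β → γ → Set α) (h : ∀ z ∈ A, ∃! k : β × γ, z ∈ F k.1 k.2)
    (hS : ∀ z ∈ A, ∀ b c, z ∈ F b c → c ∈ S) :
    A.indicator (1 : α → ℝ) = ∑ b, ∑ c ∈ S, (A ∩ F b c).indicator 1 := by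
  classical
  ext z
  simp only [Finset.sum_apply]
  by_cases hz : z ∈ A
  · obtain ⟨⟨b, c⟩, hbc, huniq⟩ := h z hz
    have hval : ∀ b' c', (A ∩ F b' c').indicator (1 : α → ℝ) z =
        if b' = b then (if c' = c then 1 else 0) else 0 := by
      intro b' c'
      by_cases hm : z ∈ F b' c'
      · obtain ⟨rfl, rfl⟩ := Prod.mk.inj (huniq (b', c') hm)
        simp [hz, hm]
      · have : ¬ (b' = b ∧ c' = c) := by rintro ⟨rfl, rfl⟩; exact hm hbc
        rw [Set.indicator_of_notMem (fun h => hm h.2)]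
        split_ifs <;> simp_all
    simp only [hval]
    simp [hz, hS z hz b c hbc]
  · simp [hz]

/-- Two finite families of half-open boxes whose translates by the same lattice partition the
plane have the same total generalized area. -/
theorem sum_box_eq_sum_box {ι κ : Type*} [Fintype ι] [Fintype κ]
    (sh : ℤ × ℤ →+ ℝ × ℝ) (hsh : ∀ R, {g | |(sh g).1| ≤ R ∧ |(sh g).2| ≤ R}.Finite)
    {a b w h : ι → ℝ} {a' b' w' h' : κ → ℝ}
    (hw : ∀ i, 0 ≤ w i) (hh : ∀ i, 0 ≤ h i) (hw' : ∀ i, 0 ≤ w' i) (hh' : ∀ i, 0 ≤ h' i)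
    (hpart : ∀ z, ∃! k : ι × (ℤ × ℤ), z - sh k.2 ∈ iocBox (a k.1) (b k.1) (w k.1) (h k.1))
    (hpart' : ∀ z, ∃! k : κ × (ℤ × ℤ), z - sh k.2 ∈ iocBox (a' k.1) (b' k.1) (w' k.1) (h' k.1))
    (f g : ℝ →ₗ[ℚ] ℝ) : ∑ i, f (w i) * g (h i) = ∑ j, f (w' j) * g (h' j) := by
  obtain ⟨M, hM⟩ := exists_functional_box f g
  -- R is so large that a box of one family meets a translate of a box of the other only if the
  -- shift has coordinates at most R in absolute value.
  set R : ℝ := ∑ i, (|a i| + |b i| + w i + h i) + ∑ j, (|a' j| + |b' j| + w' j + h' j) with hR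
  have hbound : ∀ i j, |a i| + |b i| + w i + h i + (|a' j| + |b' j| + w' j + h' j) ≤ R := by
    intro i j
    refine add_le_add ?_ ?_
    · exact Finset.single_le_sum (f := fun i => |a i| + |b i| + w i + h i)
        (fun i _ => by have := hw i; have := hh i; positivity) (Finset.mem_univ i)
    · exact Finset.single_le_sum (f := fun j => |a' j| + |b' j| + w' j + h' j)
        (fun j _ => by have := hw' j; have := hh' j; positivity) (Finset.mem_univ j)
  have hmem : ∀ i j z t, z ∈ iocBox (a i) (b i) (w i) (h i) →
      z - sh t ∈ iocBox (a' j) (b' j) (w' j) (h' j) → t ∈ (hsh R).toFinset := by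
    rintro i j ⟨x, y⟩ t ⟨⟨h1, h2⟩, h3, h4⟩ ⟨⟨h5, h6⟩, h7, h8⟩
    simp only [Prod.fst_sub, Prod.snd_sub] at h1 h2 h3 h4 h5 h6 h7 h8
    have := hbound i j
    have := hw i; have := hh i; have := hw' j; have := hh' j
    simp only [Set.Finite.mem_toFinset, Set.mem_ofPred_eq, abs_le]
    have := abs_le.1 (le_refl |a i|); have := abs_le.1 (le_refl |b i|)
    have := abs_le.1 (le_refl |a' j|); have := abs_le.1 (le_refl |b' j|)
    refine ⟨⟨?_, ?_⟩, ?_, ?_⟩ <;> linarith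
  have e1 : ∀ i, f (w i) * g (h i) = ∑ j, ∑ t ∈ (hsh R).toFinset,
      M ((iocBox (a i) (b i) (w i) (h i) ∩
        {z | z - sh t ∈ iocBox (a' j) (b' j) (w' j) (h' j)}).indicator 1) := by
    intro i
    have h1 := hM (a i) (a i + w i) (b i) (b i + h i)
    simp only [add_sub_cancel_left, max_eq_left (hw i), max_eq_left (hh i)] at h1
    have h2 := indicator_eq_sum_inter (hsh R).toFinset (iocBox (a i) (b i) (w i) (h i))
      (fun j t => {z | z - sh t ∈ iocBox (a' j) (b' j) (w' j) (h' j)})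
      (fun z _ => hpart' z) (fun z hz j t ht => hmem i j z t hz ht)
    rw [← h1, ← iocBox, h2]
    simp only [map_sum]
  have e2 : ∀ j, f (w' j) * g (h' j) = ∑ i, ∑ t ∈ (hsh R).toFinset,
      M ((iocBox (a' j) (b' j) (w' j) (h' j) ∩
        {z | z + sh t ∈ iocBox (a i) (b i) (w i) (h i)}).indicator 1) := by
    intro j
    have h1 := hM (a' j) (a' j + w' j) (b' j) (b' j + h' j)
    simp only [add_sub_cancel_left, max_eq_left (hw' j), max_eq_left (hh' j)] at h1
    have h2 := indicator_eq_sum_inter (hsh R).toFinset (iocBox (a' j) (b' j) (w' j) (h' j))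
      (fun i t => {z | z + sh t ∈ iocBox (a i) (b i) (w i) (h i)})
      (fun z _ => by
        obtain ⟨⟨i, t⟩, h1, h2⟩ := hpart z
        refine ⟨(i, -t), by simpa [sub_eq_add_neg] using h1, ?_⟩
        rintro ⟨i', t'⟩ h3
        have := h2 (i', -t') (by simpa [sub_eq_add_neg] using h3)
        rw [Prod.mk.injEq] at this ⊢
        exact ⟨this.1, by rw [← this.2, neg_neg]⟩)
      (fun z hz i t ht => hmem i j (z + sh t) t ht (by simpa using hz))
    rw [← h1, ← iocBox, h2]
    simp only [map_sum]
  rw [Finset.sum_congr rfl fun i _ => e1 i, Finset.sum_congr rfl fun j _ => e2 j,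
    Finset.sum_comm]
  refine Finset.sum_congr rfl fun j _ => Finset.sum_congr rfl fun i _ =>
    Finset.sum_congr rfl fun t _ => ?_
  have s1 : iocBox (a i) (b i) (w i) (h i) ∩
        {z | z - sh t ∈ iocBox (a' j) (b' j) (w' j) (h' j)} =
      Set.Ioc (max (a i) (a' j + (sh t).1)) (min (a i + w i) (a' j + w' j + (sh t).1)) ×ˢ
      Set.Ioc (max (b i) (b' j + (sh t).2)) (min (b i + h i) (b' j + h' j + (sh t).2)) := by
    ext ⟨x, y⟩
    simp only [iocBox, Set.mem_inter_iff, Set.mem_prod, Set.mem_Ioc, Set.mem_ofPred_eq,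
      Prod.fst_sub, Prod.snd_sub, max_lt_iff, le_min_iff, lt_sub_iff_add_lt, sub_le_iff_le_add]
    tauto
  have s2 : iocBox (a' j) (b' j) (w' j) (h' j) ∩
        {z | z + sh t ∈ iocBox (a i) (b i) (w i) (h i)} =
      Set.Ioc (max (a i) (a' j + (sh t).1) - (sh t).1)
        (min (a i + w i) (a' j + w' j + (sh t).1) - (sh t).1) ×ˢ
      Set.Ioc (max (b i) (b' j + (sh t).2) - (sh t).2)
        (min (b i + h i) (b' j + h' j + (sh t).2) - (sh t).2) := by
    ext ⟨x, y⟩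
    simp only [iocBox, Set.mem_inter_iff, Set.mem_prod, Set.mem_Ioc, Set.mem_ofPred_eq,
      Prod.fst_add, Prod.snd_add, sub_lt_iff_lt_add, le_sub_iff_add_le, max_lt_iff, le_min_iff,
      add_lt_add_iff_right, add_le_add_iff_right]
    tauto
  -- The two pieces are translates of each other by `sh t`, and M sees only side lengths.
  rw [s1, s2, hM, hM]
  simp only [sub_sub_sub_cancel_right]

/-! ### Lattice partitions by a rectangle and by an L-shaped hexagon -/

/-- The embedding of `ℤ × ℤ` as the lattice generated by `(c, s)` and `(-p, r)`. -/
noncomputable def latticeHom (c s p r : ℝ) : ℤ × ℤ →+ ℝ × ℝ where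
  toFun g := (g.1 * c - g.2 * p, g.1 * s + g.2 * r)
  map_zero' := by simp
  map_add' g g' := by
    ext
    · simp only [Prod.fst_add, Prod.snd_add]; push_cast; ring
    · simp only [Prod.fst_add, Prod.snd_add]; push_cast; ring

theorem latticeHom_apply (c s p r : ℝ) (m n : ℤ) :
    latticeHom c s p r (m, n) = (m * c - n * p, m * s + n * r) := rfl

theorem sub_latticeHom_mem_iocBox {c s p r a b w h x y : ℝ} {m n : ℤ} :
    (x, y) - latticeHom c s p r (m, n) ∈ iocBox a b w h ↔
      (a + m * c < x + n * p ∧ x + n * p ≤ a + w + m * c) ∧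
      (b + m * s < y - n * r ∧ y - n * r ≤ b + h + m * s) := by
  rw [latticeHom_apply, iocBox, Prod.mk_sub_mk, Set.mem_prod, Set.mem_Ioc, Set.mem_Ioc]
  constructor <;> rintro ⟨⟨h1, h2⟩, h3, h4⟩ <;> refine ⟨⟨?_, ?_⟩, ?_, ?_⟩ <;>
    simp only at * <;> linarith

theorem int_lt_of_mul_lt_mul {k m : ℤ} {s : ℝ} (hs : 0 < s) (h : (k : ℝ) * s < m * s) : k < m := by
  exact_mod_cast lt_of_mul_lt_mul_right h hs.le

theorem int_mul_le_mul {k m : ℤ} {s : ℝ} (hs : 0 < s) (h : k ≤ m) : (k : ℝ) * s ≤ m * s :=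
  mul_le_mul_of_nonneg_right (by exact_mod_cast h) hs.le

theorem exists_int_mul_lt_le {c : ℝ} (hc : 0 < c) (x : ℝ) :
    ∃ m : ℤ, (m : ℝ) * c < x ∧ x ≤ (m + 1) * c := by
  refine ⟨⌈x / c⌉ - 1, ?_, ?_⟩
  · rw [← lt_div_iff₀ hc]; push_cast; linarith [Int.ceil_lt_add_one (x / c)]
  · rw [← div_le_iff₀ hc]; push_cast; linarith [Int.le_ceil (x / c)]

theorem int_eq_of_mul_lt_le {c x : ℝ} (hc : 0 < c) {m k : ℤ} (h1 : (m : ℝ) * c < x)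
    (h2 : x ≤ (m + 1) * c) (h3 : (k : ℝ) * c < x) (h4 : x ≤ (k + 1) * c) : m = k := by
  have a1 : m < k + 1 := int_lt_of_mul_lt_mul hc (by push_cast; linarith)
  have a2 : k < m + 1 := int_lt_of_mul_lt_mul hc (by push_cast; linarith)
  omega

/-- The degenerate case of the hexagon, needed when the squares are parallel to the lattice
rectangle. -/
theorem rectangle_partition {c r : ℝ} (hc : 0 < c) (hr : 0 < r) (z : ℝ × ℝ) :
    ∃! k : Unit × (ℤ × ℤ), z - latticeHom c 0 0 r k.2 ∈ iocBox 0 0 c r := by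
  obtain ⟨x, y⟩ := z
  obtain ⟨m, hm1, hm2⟩ := exists_int_mul_lt_le hc x
  obtain ⟨n, hn1, hn2⟩ := exists_int_mul_lt_le hr y
  refine ⟨((), (m, n)), ?_, ?_⟩
  · simp only [sub_latticeHom_mem_iocBox]
    refine ⟨⟨?_, ?_⟩, ?_, ?_⟩ <;> linarith
  · rintro ⟨_, m', n'⟩ h
    simp only [sub_latticeHom_mem_iocBox] at h
    obtain ⟨⟨h1, h2⟩, h3, h4⟩ := h
    rw [int_eq_of_mul_lt_le hc hm1 hm2 (k := m') (by linarith) (by linarith),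
      int_eq_of_mul_lt_le hr hn1 hn2 (k := n') (by linarith) (by linarith)]

/-- The region above the infinite staircase with steps of width `c` and height `s`. -/
def AboveStaircase (c s x y : ℝ) : Prop := ∃ k : ℤ, x ≤ (k + 1) * c ∧ k * s < y

/-- The translates of an L-shaped hexagon, dissected into two boxes, partition the plane. -/
theorem hexagon_partition {c s p r : ℝ} (hc : 0 < c) (hs : 0 < s) (hp : 0 < p) (hr : 0 < r)
    (z : ℝ × ℝ) :
    ∃! k : Fin 2 × (ℤ × ℤ), z - latticeHom c s p r k.2 ∈
      iocBox (![0, c] k.1) (![0, 0] k.1) (![c, p] k.1) (![r, s] k.1) := by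
  obtain ⟨x, y⟩ := z
  -- P n says that the point is above the staircase shifted by n(-p, r). Each point is in exactly
  -- one strip between staircases n and n + 1. That strip consists of first boxes of index n and
  -- second boxes of index n + 1.
  set P : ℤ → Prop := fun n => AboveStaircase c s (x + n * p) (y - n * r)
  have hmono : ∀ {n n' : ℤ}, n ≤ n' → P n' → P n := by
    rintro n n' h ⟨k, h1, h2⟩
    have := int_mul_le_mul hp h
    have := int_mul_le_mul hr h
    exact ⟨k, by linarith, by linarith⟩
  have hex : ∃ n, P n := by
    obtain ⟨k, hk1, hk2⟩ := exists_int_mul_lt_le hs y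
    obtain ⟨N, hN⟩ := exists_nat_ge ((x - (k + 1) * c) / p)
    rw [div_le_iff₀ hp] at hN
    have : 0 ≤ (N : ℝ) * r := by positivity
    exact ⟨-N, k, by push_cast; linarith, by push_cast; linarith⟩
  have hbdd : ∃ b, ∀ n, P n → n ≤ b := by
    obtain ⟨k, hk1, hk2⟩ := exists_int_mul_lt_le hs y
    obtain ⟨N, hN⟩ := exists_nat_ge (((k + 1) * c - x) / p)
    rw [div_le_iff₀ hp] at hN
    refine ⟨N, fun n hn => ?_⟩
    by_contra! hlt
    obtain ⟨j, h1, h2⟩ := hn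
    have : 0 ≤ (N : ℝ) * r := by positivity
    have := int_mul_le_mul hp (show (N : ℤ) + 1 ≤ n by omega)
    have := int_mul_le_mul hr (show (N : ℤ) + 1 ≤ n by omega)
    push_cast at *
    have hjk : j < k + 1 := int_lt_of_mul_lt_mul hs (by push_cast; linarith)
    have hjk' := int_mul_le_mul hc (show j + 1 ≤ k + 1 by omega)
    push_cast at hjk'
    linarith
  have hn_unique : ∀ {n n' : ℤ}, P n → ¬ P (n + 1) → P n' → ¬ P (n' + 1) → n = n' := by
    intro n n' h1 h2 h3 h4
    by_contra hne
    rcases lt_or_gt_of_ne hne with h | h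
    · exact h2 (hmono (by omega) h3)
    · exact h4 (hmono (by omega) h1)
  have hR1 : ∀ {m n : ℤ}, (x, y) - latticeHom c s p r (m, n) ∈ iocBox 0 0 c r →
      P n ∧ ¬ P (n + 1) ∧ (m * c < x + n * p ∧ x + n * p ≤ (m + 1) * c) ∧
        y - n * r ≤ m * s + r := by
    intro m n h
    rw [sub_latticeHom_mem_iocBox] at h
    obtain ⟨⟨h1, h2⟩, h3, h4⟩ := h
    refine ⟨⟨m, by linarith, by linarith⟩, ?_, ⟨by linarith, by linarith⟩, by linarith⟩
    rintro ⟨k, h5, h6⟩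
    push_cast at h5 h6
    have h7 : k < m := int_lt_of_mul_lt_mul hs (by linarith)
    have h8 := int_mul_le_mul hc (show k + 1 ≤ m by omega)
    push_cast at h8
    linarith
  have hR2 : ∀ {k n : ℤ}, (x, y) - latticeHom c s p r (k, n + 1) ∈ iocBox c 0 p s →
      P n ∧ ¬ P (n + 1) ∧ x + n * p ≤ (k + 1) * c ∧
        (k * s < y - (n + 1) * r ∧ y - (n + 1) * r ≤ (k + 1) * s) := by
    intro k n h
    rw [sub_latticeHom_mem_iocBox] at h
    obtain ⟨⟨h1, h2⟩, h3, h4⟩ := h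
    push_cast at h1 h2 h3 h4
    refine ⟨⟨k, by linarith, by linarith⟩, ?_, by linarith, by linarith, by linarith⟩
    rintro ⟨k', h5, h6⟩
    push_cast at h5 h6
    have h7 : k' < k + 1 := int_lt_of_mul_lt_mul hs (by push_cast; linarith)
    have h8 := int_mul_le_mul hc (show k' + 1 ≤ k + 1 by omega)
    push_cast at h8
    linarith
  have hR2' : ∀ {k n : ℤ}, (x, y) - latticeHom c s p r (k, n) ∈ iocBox c 0 p s →
      (x, y) - latticeHom c s p r (k, (n - 1) + 1) ∈ iocBox c 0 p s := by
    intro k n h; rwa [sub_add_cancel]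
  have h12 : ∀ {m n k n' : ℤ}, (x, y) - latticeHom c s p r (m, n) ∈ iocBox 0 0 c r →
      (x, y) - latticeHom c s p r (k, n') ∈ iocBox c 0 p s → False := by
    intro m n k n' h h'
    obtain ⟨a1, a2, a3, a4⟩ := hR1 h
    obtain ⟨b1, b2, b3, b4⟩ := hR2 (hR2' h')
    obtain rfl := hn_unique a1 a2 b1 b2
    have h7 : k < m := int_lt_of_mul_lt_mul hs (by linarith)
    have h8 := int_mul_le_mul hc (show k + 1 ≤ m by omega)
    push_cast at h8
    linarith
  have hexist : (∃ m n : ℤ, (x, y) - latticeHom c s p r (m, n) ∈ iocBox 0 0 c r) ∨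
      ∃ m n : ℤ, (x, y) - latticeHom c s p r (m, n) ∈ iocBox c 0 p s := by
    obtain ⟨b, hb⟩ := hbdd
    obtain ⟨n, hn, hmax⟩ := Int.exists_greatest_of_bdd ⟨b, hb⟩ hex
    have hn' : ¬ P (n + 1) := fun h => by have := hmax _ h; omega
    obtain ⟨m, hm1, hm2⟩ := exists_int_mul_lt_le hc (x + n * p)
    have hm3 : m * s < y - n * r := by
      obtain ⟨k, hk1, hk2⟩ := hn
      have : m < k + 1 := int_lt_of_mul_lt_mul hc (by push_cast; linarith)
      have := int_mul_le_mul hs (show m ≤ k by omega)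
      linarith
    -- A point at most r above its step is in a first box; a higher one is in a second box, to the
    -- right of the end of a step of staircase n + 1.
    by_cases hy : y - n * r ≤ m * s + r
    · refine Or.inl ⟨m, n, sub_latticeHom_mem_iocBox.2 ⟨⟨?_, ?_⟩, ?_, ?_⟩⟩ <;> linarith
    · obtain ⟨k, hk1, hk2⟩ := exists_int_mul_lt_le hs (y - n * r - r)
      have hmk : m < k + 1 := int_lt_of_mul_lt_mul hs (by push_cast; linarith)
      have h8 := int_mul_le_mul hc (show m + 1 ≤ k + 1 by omega)
      push_cast at h8
      have h9 : (k + 1) * c < x + n * p + p := by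
        by_contra! hcon
        exact hn' ⟨k, by push_cast; linarith, by push_cast; linarith⟩
      refine Or.inr ⟨k, n + 1, sub_latticeHom_mem_iocBox.2 ⟨⟨?_, ?_⟩, ?_, ?_⟩⟩ <;> push_cast <;>
        linarith
  rcases hexist with ⟨m, n, h⟩ | ⟨m, n, h⟩
  · refine ⟨(0, (m, n)), h, ?_⟩
    rintro ⟨i, m', n'⟩ h'
    fin_cases i
    · obtain ⟨a1, a2, ⟨a3, a4⟩, a5⟩ := hR1 h
      obtain ⟨b1, b2, ⟨b3, b4⟩, b5⟩ := hR1 h'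
      obtain rfl := hn_unique a1 a2 b1 b2
      rw [int_eq_of_mul_lt_le hc a3 a4 b3 b4]; rfl
    · exact (h12 h h').elim
  · refine ⟨(1, (m, n)), h, ?_⟩
    rintro ⟨i, m', n'⟩ h'
    fin_cases i
    · exact (h12 h' h).elim
    · obtain ⟨a1, a2, a3, a4, a5⟩ := hR2 (hR2' h)
      obtain ⟨b1, b2, b3, b4, b5⟩ := hR2 (hR2' h')
      obtain rfl : n = n' := by have := hn_unique a1 a2 b1 b2; omega
      rw [int_eq_of_mul_lt_le hs a4 a5 b4 b5]; rfl

/-! ### Squares in a rotated frame; all squares of a tiling are parallel -/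

open Set Filter Topology

/-- The first coordinate in the orthonormal frame `(c, -s)`, `(s, c)`. -/
noncomputable def frameX (c s : ℝ) : Plane →L[ℝ] ℝ :=
  c • EuclideanSpace.proj 0 - s • EuclideanSpace.proj 1

/-- The second coordinate in the orthonormal frame `(c, -s)`, `(s, c)`. -/
noncomputable def frameY (c s : ℝ) : Plane →L[ℝ] ℝ :=
  s • EuclideanSpace.proj 0 + c • EuclideanSpace.proj 1

@[simp] theorem frameX_apply (c s : ℝ) (x : Plane) : frameX c s x = c * x 0 - s * x 1 := rfl

@[simp] theorem frameY_apply (c s : ℝ) (x : Plane) : frameY c s x = s * x 0 + c * x 1 := rfl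

/-- The closed square with sides parallel to `(c, -s)` and `(s, c)`. -/
def framedSquare (c s a b w : ℝ) : Set Plane :=
  {x | frameX c s x ∈ Icc a (a + w) ∧ frameY c s x ∈ Icc b (b + w)}

/-- `Q` is a closed square with sides parallel to `(c, -s)` and `(s, c)`. -/
def IsFramedSquare (c s : ℝ) (Q : Set Plane) : Prop :=
  ∃ a b w : ℝ, 0 < w ∧ Q = framedSquare c s a b w

theorem plane_ext {x y : Plane} (h0 : x 0 = y 0) (h1 : x 1 = y 1) : x = y := by
  ext i; fin_cases i <;> assumption

theorem IsFramedSquare.rotate {c s : ℝ} {Q : Set Plane} (h : IsFramedSquare c s Q) :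
    IsFramedSquare (-s) c Q := by
  obtain ⟨a, b, w, hw, rfl⟩ := h
  refine ⟨-b - w, a, w, hw, ?_⟩
  ext x
  simp only [framedSquare, mem_ofPred_eq, frameX_apply, frameY_apply, mem_Icc]
  constructor <;> rintro ⟨⟨h1, h2⟩, h3, h4⟩ <;> refine ⟨⟨?_, ?_⟩, ?_, ?_⟩ <;> linarith

theorem IsFramedSquare.neg {c s : ℝ} {Q : Set Plane} (h : IsFramedSquare c s Q) :
    IsFramedSquare (-c) (-s) Q := h.rotate.rotate

/-- Quarter turns of the frame bring (c, s) into the quadrant where the hexagon has nonnegative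
sides. -/
theorem exists_isFramedSquare_nonneg {c s : ℝ} {Q : Set Plane} (hcs : c ^ 2 + s ^ 2 = 1)
    (h : IsFramedSquare c s Q) :
    ∃ c' s', 0 < c' ∧ 0 ≤ s' ∧ c' ^ 2 + s' ^ 2 = 1 ∧ IsFramedSquare c' s' Q := by
  rcases lt_trichotomy c 0 with hc | rfl | hc
  · rcases lt_or_ge 0 s with hs | hs
    · refine ⟨s, -c, hs, by linarith, by linarith, ?_⟩
      simpa using h.rotate.neg
    · exact ⟨-c, -s, by linarith, by linarith, by linarith, h.neg⟩
  · rcases lt_or_ge 0 s with hs | hs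
    · exact ⟨s, 0, hs, le_rfl, by linarith, by simpa using h.rotate.neg⟩
    · refine ⟨-s, 0, ?_, le_rfl, by linarith, by simpa using h.rotate⟩
      rcases hs.lt_or_eq with hs | rfl
      · linarith
      · norm_num at hcs
  · rcases lt_or_ge s 0 with hs | hs
    · exact ⟨-s, c, by linarith, hc.le, by linarith, h.rotate⟩
    · exact ⟨c, s, hc, hs, hcs, h⟩

theorem isFramedSquare_of_sides {p u v : Plane} (hu : u ≠ 0) (h0 : v 0 = -u 1) (h1 : v 1 = u 0) :
    ∃ c s : ℝ, c ^ 2 + s ^ 2 = 1 ∧ IsFramedSquare c s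
      {x | ∃ s ∈ Icc (0 : ℝ) 1, ∃ t ∈ Icc (0 : ℝ) 1, x = p + s • u + t • v} := by
  set w := ‖u‖ with hw
  have hw0 : 0 < w := norm_pos_iff.2 hu
  have hw2 : u 0 ^ 2 + u 1 ^ 2 = w ^ 2 := by
    rw [hw, EuclideanSpace.real_norm_sq_eq, Fin.sum_univ_two]
  refine ⟨u 0 / w, -u 1 / w, by field_simp; linarith, ?_⟩
  refine ⟨(u 0 * p 0 + u 1 * p 1) / w, (-u 1 * p 0 + u 0 * p 1) / w, w, hw0, ?_⟩
  ext x
  simp only [framedSquare, mem_ofPred_eq, frameX_apply, frameY_apply, mem_Icc]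
  have e1 : u 0 / w * x 0 - -u 1 / w * x 1 = (u 0 * x 0 + u 1 * x 1) / w := by ring
  have e2 : -u 1 / w * x 0 + u 0 / w * x 1 = (-u 1 * x 0 + u 0 * x 1) / w := by ring
  have e3 : ∀ y : ℝ, y / w + w = (y + w ^ 2) / w := fun y => by field_simp
  rw [e1, e2, e3, e3, div_le_div_iff_of_pos_right hw0, div_le_div_iff_of_pos_right hw0,
    div_le_div_iff_of_pos_right hw0, div_le_div_iff_of_pos_right hw0]
  constructor
  · rintro ⟨σ, ⟨hσ0, hσ1⟩, τ, ⟨hτ0, hτ1⟩, rfl⟩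
    simp only [PiLp.add_apply, PiLp.smul_apply, smul_eq_mul, h0, h1]
    have a1 : u 0 * (p 0 + σ * u 0 + τ * -u 1) + u 1 * (p 1 + σ * u 1 + τ * u 0) =
      u 0 * p 0 + u 1 * p 1 + σ * w ^ 2 := by rw [← hw2]; ring
    have a2 : -u 1 * (p 0 + σ * u 0 + τ * -u 1) + u 0 * (p 1 + σ * u 1 + τ * u 0) =
      -u 1 * p 0 + u 0 * p 1 + τ * w ^ 2 := by rw [← hw2]; ring
    rw [a1, a2]
    have := mul_le_mul_of_nonneg_right hσ1 (sq_nonneg w)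
    have := mul_le_mul_of_nonneg_right hτ1 (sq_nonneg w)
    have := mul_nonneg hσ0 (sq_nonneg w)
    have := mul_nonneg hτ0 (sq_nonneg w)
    refine ⟨⟨?_, ?_⟩, ?_, ?_⟩ <;> linarith
  · rintro ⟨⟨b1, b2⟩, b3, b4⟩
    have hw2' : 0 < w ^ 2 := by positivity
    refine ⟨(u 0 * (x 0 - p 0) + u 1 * (x 1 - p 1)) / w ^ 2, ⟨?_, ?_⟩,
      (-u 1 * (x 0 - p 0) + u 0 * (x 1 - p 1)) / w ^ 2, ⟨?_, ?_⟩, ?_⟩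
    · apply div_nonneg _ hw2'.le; linarith
    · rw [div_le_one hw2']; linarith
    · apply div_nonneg _ hw2'.le; linarith
    · rw [div_le_one hw2']; linarith
    · apply plane_ext
      · simp only [PiLp.add_apply, PiLp.smul_apply, smul_eq_mul, h0]
        field_simp
        rw [← hw2]; ring
      · simp only [PiLp.add_apply, PiLp.smul_apply, smul_eq_mul, h1]
        field_simp
        rw [← hw2]; ring

theorem IsClosedSquare.exists_isFramedSquare {Q : Set Plane} (h : IsClosedSquare Q) :
    ∃ c s : ℝ, c ^ 2 + s ^ 2 = 1 ∧ IsFramedSquare c s Q := by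
  obtain ⟨p, u, v, hu, hn, hin, rfl⟩ := h
  have hn2 : u 0 ^ 2 + u 1 ^ 2 = v 0 ^ 2 + v 1 ^ 2 := by
    have := congrArg (· ^ 2) hn
    simpa [EuclideanSpace.real_norm_sq_eq, Fin.sum_univ_two] using this
  have hin2 : u 0 * v 0 + u 1 * v 1 = 0 := by
    rw [PiLp.inner_apply, Fin.sum_univ_two] at hin
    simp only [RCLike.inner_apply, conj_trivial] at hin
    linarith
  have hpos : 0 < u 0 ^ 2 + u 1 ^ 2 := by
    rw [← Fin.sum_univ_two (fun i => u i ^ 2), ← EuclideanSpace.real_norm_sq_eq]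
    have := norm_pos_iff.2 hu
    positivity
  have hv : v ≠ 0 := by
    intro hv
    rw [hv, norm_zero] at hn
    exact hu (norm_eq_zero.1 hn)
  -- Lagrange's identity: the determinant of (u, v) is ± |u|². For the minus sign u and v exchange
  -- roles.
  have hk : (-u 1 * v 0 + u 0 * v 1) ^ 2 = (u 0 ^ 2 + u 1 ^ 2) ^ 2 := by
    have : (-u 1 * v 0 + u 0 * v 1) ^ 2 + (u 0 * v 0 + u 1 * v 1) ^ 2 =
      (u 0 ^ 2 + u 1 ^ 2) * (v 0 ^ 2 + v 1 ^ 2) := by ring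
    rw [hin2, ← hn2] at this
    linarith
  rcases sq_eq_sq_iff_eq_or_eq_neg.1 hk with hk | hk
  · apply isFramedSquare_of_sides hu
    · apply mul_left_cancel₀ hpos.ne'
      linear_combination u 0 * hin2 - u 1 * hk
    · apply mul_left_cancel₀ hpos.ne'
      linear_combination u 1 * hin2 + u 0 * hk
  · have hvu : u 0 = -v 1 ∧ u 1 = v 0 := by
      constructor
      · apply mul_left_cancel₀ hpos.ne'
        linear_combination u 1 * hin2 + u 0 * hk
      · apply mul_left_cancel₀ hpos.ne'
        linear_combination -u 0 * hin2 + u 1 * hk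
    obtain ⟨c, s, hcs, h⟩ := isFramedSquare_of_sides (p := p) hv hvu.1 hvu.2
    refine ⟨c, s, hcs, ?_⟩
    convert h using 1
    ext x
    constructor
    · rintro ⟨σ, hσ, τ, hτ, rfl⟩
      exact ⟨τ, hτ, σ, hσ, by abel⟩
    · rintro ⟨σ, hσ, τ, hτ, rfl⟩
      exact ⟨τ, hτ, σ, hσ, by abel⟩

theorem exists_frame_point {c s : ℝ} (hcs : c ^ 2 + s ^ 2 = 1) (X Y : ℝ) :
    frameX c s !₂[c * X + s * Y, -s * X + c * Y] = X ∧
      frameY c s !₂[c * X + s * Y, -s * X + c * Y] = Y := by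
  simp only [frameX_apply, frameY_apply, Matrix.cons_val_zero,
    Matrix.cons_val_one]
  constructor
  · linear_combination X * hcs
  · linear_combination Y * hcs

theorem frame_ext {c s : ℝ} (hcs : c ^ 2 + s ^ 2 = 1) {x y : Plane}
    (hX : frameX c s x = frameX c s y) (hY : frameY c s x = frameY c s y) : x = y := by
  simp only [frameX_apply, frameY_apply] at hX hY
  apply plane_ext
  · linear_combination c * hX + s * hY - (x 0 - y 0) * hcs
  · linear_combination -s * hX + c * hY - (x 1 - y 1) * hcs

theorem mem_interior_framedSquare {c s a b w : ℝ} {x : Plane}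
    (hX : frameX c s x ∈ Ioo a (a + w)) (hY : frameY c s x ∈ Ioo b (b + w)) :
    x ∈ interior (framedSquare c s a b w) := by
  have hopen : IsOpen {x | frameX c s x ∈ Ioo a (a + w) ∧ frameY c s x ∈ Ioo b (b + w)} :=
    (isOpen_Ioo.preimage (frameX c s).continuous).inter
      (isOpen_Ioo.preimage (frameY c s).continuous)
  have hsub : {x | frameX c s x ∈ Ioo a (a + w) ∧ frameY c s x ∈ Ioo b (b + w)} ⊆
      framedSquare c s a b w :=
    fun y hy => ⟨Ioo_subset_Icc_self hy.1, Ioo_subset_Icc_self hy.2⟩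
  exact interior_maximal hsub hopen ⟨hX, hY⟩

theorem isClosed_framedSquare (c s a b w : ℝ) : IsClosed (framedSquare c s a b w) :=
  (isClosed_Icc.preimage (frameX c s).continuous).inter
    (isClosed_Icc.preimage (frameY c s).continuous)

theorem convex_framedSquare (c s a b w : ℝ) : Convex ℝ (framedSquare c s a b w) :=
  ((convex_Icc a (a + w)).linear_preimage (frameX c s).toLinearMap).inter
    ((convex_Icc b (b + w)).linear_preimage (frameY c s).toLinearMap)

theorem nonempty_interior_framedSquare {c s : ℝ} (hcs : c ^ 2 + s ^ 2 = 1) (a b : ℝ) {w : ℝ}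
    (hw : 0 < w) : (interior (framedSquare c s a b w)).Nonempty := by
  obtain ⟨h1, h2⟩ := exists_frame_point hcs (a + w / 2) (b + w / 2)
  refine ⟨!₂[c * (a + w / 2) + s * (b + w / 2), -s * (a + w / 2) + c * (b + w / 2)],
    mem_interior_framedSquare ?_ ?_⟩
  · rw [h1]; constructor <;> linarith
  · rw [h2]; constructor <;> linarith

/-- If a linear functional attains its maximum on a square at two distinct points, then it is
constant along one of the sides. -/
theorem functional_constant_on_side {c s a b w u : ℝ} (hcs : c ^ 2 + s ^ 2 = 1)
    (f : Plane →L[ℝ] ℝ) (hf : ∀ x ∈ framedSquare c s a b w, f x ≤ u) {y z : Plane} (hyz : y ≠ z)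
    (hy : y ∈ framedSquare c s a b w) (hz : z ∈ framedSquare c s a b w) (hfy : f y = u)
    (hfz : f z = u) : c * f !₂[1, 0] - s * f !₂[0, 1] = 0 ∨ s * f !₂[1, 0] + c * f !₂[0, 1] = 0 := by
  set α := c * f !₂[1, 0] - s * f !₂[0, 1] with hα
  set β := s * f !₂[1, 0] + c * f !₂[0, 1] with hβ
  have hfx : ∀ x, f x = α * frameX c s x + β * frameY c s x := by
    intro x
    have hx : x = x 0 • !₂[1, 0] + x 1 • !₂[0, 1] := by
      apply plane_ext <;> simp
    have h1 : f x = x 0 * f !₂[1, 0] + x 1 * f !₂[0, 1] := by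
      conv_lhs => rw [hx]
      rw [map_add, map_smul, map_smul, smul_eq_mul, smul_eq_mul]
    rw [h1, hα, hβ, frameX_apply, frameY_apply]
    linear_combination -(x 0 * f !₂[1, 0] + x 1 * f !₂[0, 1]) * hcs
  have hbox : ∀ X ∈ Icc a (a + w), ∀ Y ∈ Icc b (b + w), α * X + β * Y ≤ u := by
    intro X hX Y hY
    obtain ⟨h1, h2⟩ := exists_frame_point hcs X Y
    have := hf !₂[c * X + s * Y, -s * X + c * Y] ⟨by rwa [h1], by rwa [h2]⟩
    rwa [hfx, h1, h2] at this
  rw [hfx] at hfy hfz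
  by_contra! hne
  -- Exchanging coordinates of the two maximizers gives points of the square where the functional is
  -- still at most u; this forces equality in each coordinate term.
  have hX1 := hbox _ hz.1 _ hy.2
  have hX2 := hbox _ hy.1 _ hz.2
  apply hyz
  apply frame_ext hcs
  · apply mul_left_cancel₀ hne.1; linarith
  · apply mul_left_cancel₀ hne.2; linarith

/-- Parallel or perpendicular unit vectors differ by a power of the quarter turn, which preserves
being framed. -/
theorem IsFramedSquare.of_frame_eq {c s c' s' : ℝ} {Q : Set Plane} (hcs : c ^ 2 + s ^ 2 = 1)
    (hcs' : c' ^ 2 + s' ^ 2 = 1) (h : IsFramedSquare c' s' Q)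
    (hpar : c * s' - s * c' = 0 ∨ c * c' + s * s' = 0) : IsFramedSquare c s Q := by
  rcases hpar with hpar | hpar
  · have hk : (c * c' + s * s') ^ 2 = 1 := by
      have : (c * c' + s * s') ^ 2 + (c * s' - s * c') ^ 2 =
        (c ^ 2 + s ^ 2) * (c' ^ 2 + s' ^ 2) := by ring
      rw [hpar, hcs, hcs'] at this; linarith
    have e1 : c = (c * c' + s * s') * c' := by linear_combination -c * hcs' + s' * hpar
    have e2 : s = (c * c' + s * s') * s' := by linear_combination -s * hcs' - c' * hpar
    rcases sq_eq_sq_iff_eq_or_eq_neg.1 (hk.trans (one_pow 2).symm) with hk | hk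
    · rw [hk] at e1 e2; rw [e1, e2]; simpa using h
    · rw [hk] at e1 e2; rw [e1, e2]; simpa using h.neg
  · have hk : (c * s' - s * c') ^ 2 = 1 := by
      have : (c * c' + s * s') ^ 2 + (c * s' - s * c') ^ 2 =
        (c ^ 2 + s ^ 2) * (c' ^ 2 + s' ^ 2) := by ring
      rw [hpar, hcs, hcs'] at this; linarith
    have e1 : c = (c * s' - s * c') * s' := by linear_combination -c * hcs' + c' * hpar
    have e2 : s = -(c * s' - s * c') * c' := by linear_combination -s * hcs' + s' * hpar
    rcases sq_eq_sq_iff_eq_or_eq_neg.1 (hk.trans (one_pow 2).symm) with hk | hk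
    · rw [hk] at e1 e2; rw [e1, e2]; simpa using h.rotate.neg
    · rw [hk] at e1 e2; rw [e1, e2]; simpa using h.rotate

/-- Two squares without common interior points that share two distinct points are parallel. -/
theorem IsFramedSquare.of_common_points {c s c' s' : ℝ} {Q Q' : Set Plane}
    (hcs : c ^ 2 + s ^ 2 = 1) (hcs' : c' ^ 2 + s' ^ 2 = 1) (hQ : IsFramedSquare c s Q)
    (hQ' : IsFramedSquare c' s' Q') (hdisj : Disjoint (interior Q) (interior Q')) {y z : Plane}
    (hyz : y ≠ z) (hy : y ∈ Q ∩ Q') (hz : z ∈ Q ∩ Q') : IsFramedSquare c s Q' := by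
  refine hQ'.of_frame_eq hcs hcs' ?_
  obtain ⟨a, b, w, hw, rfl⟩ := hQ
  obtain ⟨a', b', w', hw', rfl⟩ := hQ'
  -- A line separates the interiors. Both common points lie on it, so it runs along a side of each
  -- square.
  obtain ⟨f, u, hfu, huf⟩ := geometric_hahn_banach_open_open
    (convex_framedSquare c s a b w).interior isOpen_interior
    (convex_framedSquare c' s' a' b' w').interior isOpen_interior hdisj
  have hne := nonempty_interior_framedSquare hcs a b hw
  have hne' := nonempty_interior_framedSquare hcs' a' b' hw'
  have h1 : ∀ x ∈ framedSquare c s a b w, f x ≤ u := by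
    have hsub : closure (interior (framedSquare c s a b w)) ⊆ {x | f x ≤ u} :=
      closure_minimal (fun x hx => (hfu x hx).le) (isClosed_le f.continuous continuous_const)
    rw [(convex_framedSquare c s a b w).closure_interior_eq_closure_of_nonempty_interior hne,
      (isClosed_framedSquare c s a b w).closure_eq] at hsub
    exact hsub
  have h2 : ∀ x ∈ framedSquare c' s' a' b' w', u ≤ f x := by
    have hsub : closure (interior (framedSquare c' s' a' b' w')) ⊆ {x | u ≤ f x} :=
      closure_minimal (fun x hx => (huf x hx).le) (isClosed_le continuous_const f.continuous)
    rw [(convex_framedSquare c' s' a' b' w').closure_interior_eq_closure_of_nonempty_interior hne',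
      (isClosed_framedSquare c' s' a' b' w').closure_eq] at hsub
    exact hsub
  have hfy := le_antisymm (h1 y hy.1) (h2 y hy.2)
  have hfz := le_antisymm (h1 z hz.1) (h2 z hz.2)
  have k1 := functional_constant_on_side hcs f h1 hyz hy.1 hz.1 hfy hfz
  have k2 := functional_constant_on_side hcs' (-f) (u := -u)
    (fun x hx => neg_le_neg (h2 x hx)) hyz hy.2 hz.2 (congrArg Neg.neg hfy) (congrArg Neg.neg hfz)
  have hf0 : f !₂[1, 0] ≠ 0 ∨ f !₂[0, 1] ≠ 0 := by
    by_contra! hcon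
    obtain ⟨x, hx⟩ := hne
    obtain ⟨x', hx'⟩ := hne'
    have hz : ∀ x, f x = 0 := by
      intro x
      have hx : x = x 0 • !₂[1, 0] + x 1 • !₂[0, 1] := by
        apply plane_ext <;> simp
      rw [hx, map_add, map_smul, map_smul, hcon.1, hcon.2]; simp
    have a1 := hfu x hx
    have a2 := huf x' hx'
    rw [hz] at a1 a2
    linarith
  simp only [neg_apply] at k2
  set p := f !₂[1, 0]
  set q := f !₂[0, 1]
  have cancel : ∀ t : ℝ, t * p = 0 → t * q = 0 → t = 0 := by
    intro t hp hq
    rcases hf0 with h | h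
    · exact (mul_eq_zero.1 hp).resolve_right h
    · exact (mul_eq_zero.1 hq).resolve_right h
  rcases k1 with k1 | k1 <;> rcases k2 with k2 | k2
  · left; apply cancel
    · linear_combination s' * k1 + s * k2
    · linear_combination c' * k1 + c * k2
  · right; apply cancel
    · linear_combination c' * k1 - s * k2
    · linear_combination -s' * k1 - c * k2
  · right; apply cancel
    · linear_combination s' * k1 - c * k2
    · linear_combination c' * k1 + s * k2
  · left; apply cancel
    · linear_combination -c' * k1 - c * k2
    · linear_combination s' * k1 + s * k2

/-- All the squares of a locally finite tiling of the plane are parallel to each other. -/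
theorem isFramedSquare_of_tiling {κ : Type*} [Countable κ] {F : κ → Set Plane}
    (hF : ∀ k, IsClosedSquare (F k)) (hlf : LocallyFinite F) (hcov : ⋃ k, F k = univ)
    (hdisj : ∀ k l, k ≠ l → Disjoint (interior (F k)) (interior (F l))) {c s : ℝ}
    (hcs : c ^ 2 + s ^ 2 = 1) {k₀ : κ} (hk₀ : IsFramedSquare c s (F k₀)) (k : κ) :
    IsFramedSquare c s (F k) := by
  by_contra hk
  set P : Set κ := {k | IsFramedSquare c s (F k)}
  have hclosed : ∀ k, IsClosed (F k) := by
    intro k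
    obtain ⟨c', s', -, a, b, w, -, h⟩ := (hF k).exists_isFramedSquare
    rw [h]; exact isClosed_framedSquare _ _ _ _ _
  have hint : ∀ k, (interior (F k)).Nonempty := by
    intro k
    obtain ⟨c', s', hcs', a, b, w, hw, h⟩ := (hF k).exists_isFramedSquare
    rw [h]; exact nonempty_interior_framedSquare hcs' _ _ hw
  have hU : ∀ S : Set κ, IsClosed (⋃ k : S, F k) := fun S =>
    (hlf.comp_injective Subtype.val_injective).isClosed_iUnion fun k => hclosed k
  set A : Set Plane := ⋃ k : P, F k with hA
  set B : Set Plane := ⋃ k : (Pᶜ : Set κ), F k with hB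
  -- A square parallel to the given one and a square that is not share at most one point.
  have hcount : (A ∩ B).Countable := by
    have hsub : A ∩ B ⊆ ⋃ k : P, ⋃ l : (Pᶜ : Set κ), F k ∩ F l := by
      rintro x ⟨hxA, hxB⟩
      simp only [hA, hB, mem_iUnion] at hxA hxB ⊢
      obtain ⟨k, hk⟩ := hxA
      obtain ⟨l, hl⟩ := hxB
      exact ⟨k, l, hk, hl⟩
    refine Countable.mono hsub (countable_iUnion fun k => countable_iUnion fun l => ?_)
    apply Subsingleton.countable
    intro y hy z hz
    by_contra hyz
    obtain ⟨c', s', hcs', hl⟩ := (hF l).exists_isFramedSquare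
    refine l.2 (IsFramedSquare.of_common_points hcs hcs' k.2 hl (hdisj _ _ ?_) hyz hy hz)
    intro hkl
    exact l.2 (hkl ▸ k.2)
  have hdense := hcount.dense_compl ℝ
  have hconn : IsPreconnected (A ∩ B)ᶜ :=
    (hcount.isPathConnected_compl_of_one_lt_rank (by
      rw [← Module.finrank_eq_rank]; simp)).isConnected.isPreconnected
  have meet : ∀ k, ((A ∩ B)ᶜ ∩ F k).Nonempty := fun k =>
    (hdense.inter_open_nonempty _ isOpen_interior (hint k)).mono
      fun x hx => ⟨hx.2, interior_subset hx.1⟩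
  -- The complement of A ∩ B is connected, covered by the closed sets A and B, and meets both; so it
  -- would contain a point of A ∩ B.
  obtain ⟨x, hx, hx'⟩ := isPreconnected_closed_iff.1 hconn A B (hU _) (hU _)
    (fun x _ => by
      obtain ⟨k, hk⟩ := mem_iUnion.1 (hcov.ge (mem_univ x))
      by_cases hkP : k ∈ P
      · exact Or.inl (mem_iUnion.2 ⟨⟨k, hkP⟩, hk⟩)
      · exact Or.inr (mem_iUnion.2 ⟨⟨k, hkP⟩, hk⟩))
    ((meet k₀).mono (inter_subset_inter_right _ fun x hx => mem_iUnion.2 ⟨⟨k₀, hk₀⟩, hx⟩))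
    ((meet k).mono (inter_subset_inter_right _ fun x hx => mem_iUnion.2 ⟨⟨k, hk⟩, hx⟩))
  exact hx hx'

/-! ### Lattice tilings by squares -/

/-- The lattice vector `(m a, n a lam)`. -/
noncomputable def latticeVec (a lam : ℝ) (m n : ℤ) : Plane := !₂[(m : ℝ) * a, (n : ℝ) * (a * lam)]

@[simp] theorem latticeVec_zero_coord (a lam : ℝ) (m n : ℤ) : latticeVec a lam m n 0 = m * a := rfl

@[simp] theorem latticeVec_one_coord (a lam : ℝ) (m n : ℤ) :
    latticeVec a lam m n 1 = n * (a * lam) := rfl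

theorem finite_int_abs_mul_le {a : ℝ} (ha : 0 < a) (R : ℝ) : {m : ℤ | |(m : ℝ) * a| ≤ R}.Finite := by
  refine (finite_Icc (-⌈R / a⌉) ⌈R / a⌉).subset fun m hm => ?_
  have h : |(m : ℝ)| ≤ ⌈R / a⌉ := by
    refine le_trans ?_ (Int.le_ceil _)
    have hm' : |(m : ℝ) * a| ≤ R := hm
    rwa [abs_mul, abs_of_pos ha, ← le_div_iff₀ ha] at hm'
  exact abs_le.1 (by exact_mod_cast h)

theorem finite_latticeHom_le {C S lam : ℝ} (hC : 0 < C) (hlam : 0 < lam) (R : ℝ) :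
    {g | |(latticeHom C S (lam * S) (lam * C) g).1| ≤ R ∧
      |(latticeHom C S (lam * S) (lam * C) g).2| ≤ R}.Finite := by
  have hpos : 0 < C ^ 2 + S ^ 2 := by positivity
  have h1 := finite_int_abs_mul_le hpos (|C| * R + |S| * R)
  have h2 := finite_int_abs_mul_le (mul_pos hlam hpos) (|S| * R + |C| * R)
  refine (h1.prod h2).subset ?_
  rintro ⟨m, n⟩ ⟨hX, hY⟩
  rw [latticeHom_apply] at hX hY
  simp only at hX hY
  constructor
  · have : (m : ℝ) * (C ^ 2 + S ^ 2) =
        C * (m * C - n * (lam * S)) + S * (m * S + n * (lam * C)) := by ring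
    simp only [mem_ofPred_eq]
    rw [this]
    refine (abs_add_le _ _).trans ?_
    rw [abs_mul, abs_mul]
    gcongr
  · have : (n : ℝ) * (lam * (C ^ 2 + S ^ 2)) =
        -S * (m * C - n * (lam * S)) + C * (m * S + n * (lam * C)) := by ring
    simp only [mem_ofPred_eq]
    rw [this]
    refine (abs_add_le _ _).trans ?_
    rw [abs_mul, abs_mul, abs_neg]
    gcongr

theorem IsClosedSquare.exists_bound {Q : Set Plane} (h : IsClosedSquare Q) :
    ∃ R, ∀ x ∈ Q, |x 0| ≤ R ∧ |x 1| ≤ R := by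
  obtain ⟨p, u, v, -, -, -, rfl⟩ := h
  have key : ∀ (i : Fin 2), ∀ s ∈ Icc (0 : ℝ) 1, ∀ t ∈ Icc (0 : ℝ) 1,
      |(p + s • u + t • v) i| ≤ |p i| + |u i| + |v i| := by
    intro i s hs t ht
    simp only [PiLp.add_apply, PiLp.smul_apply, smul_eq_mul]
    refine (abs_add_three _ _ _).trans ?_
    rw [abs_mul, abs_mul, abs_of_nonneg hs.1, abs_of_nonneg ht.1]
    gcongr
    · exact mul_le_of_le_one_left (abs_nonneg _) hs.2
    · exact mul_le_of_le_one_left (abs_nonneg _) ht.2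
  refine ⟨max (|p 0| + |u 0| + |v 0|) (|p 1| + |u 1| + |v 1|), ?_⟩
  rintro x ⟨s, hs, t, ht, rfl⟩
  exact ⟨(key 0 s hs t ht).trans (le_max_left _ _), (key 1 s hs t ht).trans (le_max_right _ _)⟩

theorem IsClosedSquare.preimage_sub {Q : Set Plane} (h : IsClosedSquare Q) (g : Plane) :
    IsClosedSquare ((fun x => x - g) ⁻¹' Q) := by
  obtain ⟨p, u, v, hu, hn, hin, rfl⟩ := h
  refine ⟨p + g, u, v, hu, hn, hin, ?_⟩
  ext x
  simp only [mem_preimage, mem_ofPred_eq]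
  refine exists_congr fun s => and_congr_right fun _ => exists_congr fun t =>
    and_congr_right fun _ => ?_
  rw [sub_eq_iff_eq_add]
  constructor <;> rintro rfl <;> abel

theorem interior_preimage_sub (Q : Set Plane) (g : Plane) :
    interior ((fun x => x - g) ⁻¹' Q) = (fun x => x - g) ⁻¹' interior Q :=
  ((Homeomorph.subRight g).preimage_interior Q).symm

theorem abs_coord_le_norm (x : Plane) (i : Fin 2) : |x i| ≤ ‖x‖ := by
  simpa using PiLp.norm_apply_le x i

/-- Finitely many squares have locally finitely many translates by vectors of a lattice. -/
theorem locallyFinite_translates {ι : Type*} [Finite ι] {Q : ι → Set Plane}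
    (hQ : ∀ i, IsClosedSquare (Q i)) {a lam : ℝ} (ha : 0 < a) (hlam : 0 < lam) :
    LocallyFinite fun k : ι × (ℤ × ℤ) => (fun x => x - latticeVec a lam k.2.1 k.2.2) ⁻¹' Q k.1 := by
  intro x
  choose R hR using fun i => (hQ i).exists_bound
  obtain ⟨R₀, hR₀⟩ := (finite_range R).bddAbove
  refine ⟨Metric.ball x 1, Metric.ball_mem_nhds x one_pos, ?_⟩
  have h1 := finite_int_abs_mul_le ha (R₀ + (‖x‖ + 1))
  have h2 := finite_int_abs_mul_le (mul_pos ha hlam) (R₀ + (‖x‖ + 1))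
  refine (finite_univ.prod (h1.prod h2)).subset ?_
  rintro ⟨i, m, n⟩ ⟨y, hy, hyx⟩
  have hy' := hR i _ hy
  have hRi : R i ≤ R₀ := hR₀ (mem_range_self i)
  have hynorm : ‖y‖ ≤ ‖x‖ + 1 := by
    have := norm_le_norm_add_norm_sub' y x
    rw [Metric.mem_ball, dist_eq_norm] at hyx
    linarith
  simp only [PiLp.sub_apply, latticeVec_zero_coord, latticeVec_one_coord] at hy'
  have a0 := abs_coord_le_norm y 0
  have a1 := abs_coord_le_norm y 1
  refine ⟨mem_univ _, ?_, ?_⟩ <;> simp only [mem_ofPred_eq]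
  · have := abs_sub_abs_le_abs_sub ((m : ℝ) * a) (y 0)
    rw [abs_sub_comm] at this
    linarith [hy'.1]
  · have := abs_sub_abs_le_abs_sub ((n : ℝ) * (a * lam)) (y 1)
    rw [abs_sub_comm] at this
    linarith [hy'.2]

/-- This and the next lemma pass from closed squares with disjoint interiors to a partition into
half-open boxes: a small shift down and left avoids all boundaries. -/
theorem eventually_sub_mem_Ioo {x p q : ℝ} (h : x ∈ Ioc p q) :
    ∀ᶠ ε in 𝓝[>] (0 : ℝ), x - ε ∈ Ioo p q := by
  filter_upwards [Ioo_mem_nhdsGT (sub_pos.2 h.1)] with ε hε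
  constructor
  · linarith [hε.2]
  · linarith [hε.1, h.2]

theorem eventually_sub_notMem_Icc {x p q : ℝ} (h : x ∉ Ioc p q) :
    ∀ᶠ ε in 𝓝[>] (0 : ℝ), x - ε ∉ Icc p q := by
  rcases le_or_gt x p with hx | hx
  · filter_upwards [self_mem_nhdsWithin] with ε hε hmem
    have : 0 < ε := hε
    linarith [hmem.1]
  · have hq : q < x := by
      by_contra! hq
      exact h ⟨hx, hq⟩
    filter_upwards [Ioo_mem_nhdsGT (sub_pos.2 hq)] with ε hε hmem
    linarith [hmem.2, hε.2]

/-- The generators (a, 0) and (0, aλ) have frame coordinates a(c, s) and aλ(-s, c), the shape of the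
hexagon lattice. -/
theorem frame_sub_latticeVec {c s : ℝ} (hcs : c ^ 2 + s ^ 2 = 1) (a lam X Y : ℝ) (m n : ℤ) :
    frameX c s (!₂[c * X + s * Y, -s * X + c * Y] - latticeVec a lam m n) =
        X - (latticeHom (a * c) (a * s) (lam * (a * s)) (lam * (a * c)) (m, n)).1 ∧
      frameY c s (!₂[c * X + s * Y, -s * X + c * Y] - latticeVec a lam m n) =
        Y - (latticeHom (a * c) (a * s) (lam * (a * s)) (lam * (a * c)) (m, n)).2 := by
  rw [map_sub, map_sub, (exists_frame_point hcs X Y).1, (exists_frame_point hcs X Y).2,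
    latticeHom_apply]
  simp only [frameX_apply, frameY_apply, latticeVec_zero_coord, latticeVec_one_coord]
  constructor <;> ring

/-- A lattice tiling by squares forces the ratio of the sides of the lattice rectangle to be a
rational number or a quadratic irrational with nonnegative conjugate. -/
theorem isTwoRootForm_of_lattice_tiling {ι : Type*} [Fintype ι] {Q : ι → Set Plane}
    (hQ : ∀ i, IsClosedSquare (Q i)) {a lam : ℝ} (ha : 0 < a) (hlam : 0 < lam)
    (hcov : ∀ x, ∃ i m n, x - latticeVec a lam m n ∈ Q i)
    (hdisj : ∀ x i m n j m' n', x - latticeVec a lam m n ∈ interior (Q i) →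
      x - latticeVec a lam m' n' ∈ interior (Q j) → i = j ∧ m = m' ∧ n = n') :
    IsTwoRootForm lam := by
  set F : ι × (ℤ × ℤ) → Set Plane :=
    fun k => (fun x => x - latticeVec a lam k.2.1 k.2.2) ⁻¹' Q k.1 with hF
  have hlf : LocallyFinite F := locallyFinite_translates hQ ha hlam
  obtain ⟨i₀, m₀, n₀, -⟩ := hcov 0
  obtain ⟨c', s', hcs', h₀'⟩ := (hQ i₀).exists_isFramedSquare
  obtain ⟨c, s, hc, hs, hcs, h₀⟩ := exists_isFramedSquare_nonneg hcs' h₀'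
  have hvec0 : latticeVec a lam 0 0 = 0 := by apply plane_ext <;> simp
  have hF0 : ∀ i, F (i, (0, 0)) = Q i := by
    intro i; simp [hF, hvec0]
  have hframed : ∀ i, IsFramedSquare c s (Q i) := by
    intro i
    have hk₀ : IsFramedSquare c s (F (i₀, (0, 0))) := by rwa [hF0]
    rw [← hF0 i]
    refine isFramedSquare_of_tiling (F := F) (fun k => (hQ k.1).preimage_sub _) hlf ?_ ?_ hcs
      hk₀ _
    · refine eq_univ_of_forall fun x => ?_
      obtain ⟨i, m, n, h⟩ := hcov x
      exact mem_iUnion.2 ⟨(i, (m, n)), h⟩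
    · rintro ⟨i, m, n⟩ ⟨j, m', n'⟩ hne
      rw [Set.disjoint_left]
      intro x hx hx'
      rw [interior_preimage_sub] at hx hx'
      obtain ⟨rfl, rfl, rfl⟩ := hdisj x i m n j m' n' hx hx'
      exact hne rfl
  choose α β w hw hQw using hframed
  set sh := latticeHom (a * c) (a * s) (lam * (a * s)) (lam * (a * c)) with hsh
  set pt : ℝ → ℝ → Plane := fun X Y => !₂[c * X + s * Y, -s * X + c * Y] with hpt
  have hframe : ∀ X Y m n, frameX c s (pt X Y - latticeVec a lam m n) = X - (sh (m, n)).1 ∧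
      frameY c s (pt X Y - latticeVec a lam m n) = Y - (sh (m, n)).2 :=
    frame_sub_latticeVec hcs a lam
  have hmemF : ∀ X Y (k : ι × (ℤ × ℤ)), pt X Y ∈ F k ↔
      X - (sh k.2).1 ∈ Icc (α k.1) (α k.1 + w k.1) ∧
      Y - (sh k.2).2 ∈ Icc (β k.1) (β k.1 + w k.1) := by
    rintro X Y ⟨i, m, n⟩
    simp only [hF, mem_preimage, hQw, framedSquare, mem_ofPred_eq]
    rw [(hframe X Y m n).1, (hframe X Y m n).2]
  have hint : ∀ X Y (k : ι × (ℤ × ℤ)), X - (sh k.2).1 ∈ Ioo (α k.1) (α k.1 + w k.1) →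
      Y - (sh k.2).2 ∈ Ioo (β k.1) (β k.1 + w k.1) →
      pt X Y - latticeVec a lam k.2.1 k.2.2 ∈ interior (Q k.1) := by
    rintro X Y ⟨i, m, n⟩ hX hY
    rw [hQw]
    apply mem_interior_framedSquare
    · rw [(hframe X Y m n).1]; exact hX
    · rw [(hframe X Y m n).2]; exact hY
  have hpart : ∀ z, ∃! k : ι × (ℤ × ℤ),
      z - sh k.2 ∈ iocBox (α k.1) (β k.1) (w k.1) (w k.1) := by
    rintro ⟨X, Y⟩
    apply existsUnique_of_exists_of_unique
    -- Only finitely many tiles come near the point, so one small diagonal shift leaves them all,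
    -- against the covering.
    · by_contra! hnone
      obtain ⟨U, hU, hfin⟩ := hlf (pt X Y)
      have hcont : Continuous fun ε : ℝ => pt (X - ε) (Y - ε) := by
        simp only [hpt]; fun_prop
      have hev : ∀ᶠ ε in 𝓝[>] (0 : ℝ), pt (X - ε) (Y - ε) ∈ U := by
        refine (hcont.tendsto' 0 (pt X Y) (by simp)).mono_left nhdsWithin_le_nhds |>.eventually hU
      have hev' : ∀ᶠ ε in 𝓝[>] (0 : ℝ), ∀ k ∈ {k | (F k ∩ U).Nonempty},
          pt (X - ε) (Y - ε) ∉ F k := by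
        refine (eventually_all_finite hfin).2 fun k _ => ?_
        have hk := hnone k
        rw [iocBox, mem_prod, not_and_or] at hk
        rcases hk with hk | hk
        · filter_upwards [eventually_sub_notMem_Icc hk] with ε hε hmem
          apply hε
          have := ((hmemF _ _ _).1 hmem).1
          rwa [sub_right_comm] at this
        · filter_upwards [eventually_sub_notMem_Icc hk] with ε hε hmem
          apply hε
          have := ((hmemF _ _ _).1 hmem).2
          rwa [sub_right_comm] at this
      obtain ⟨ε, h1, h2⟩ := (hev.and hev').exists
      obtain ⟨i, m, n, h⟩ := hcov (pt (X - ε) (Y - ε))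
      exact h2 (i, (m, n)) ⟨_, h, h1⟩ h
    · rintro k l ⟨hk1, hk2⟩ ⟨hl1, hl2⟩
      obtain ⟨ε, h1, h2, h3, h4⟩ := ((eventually_sub_mem_Ioo hk1).and
        ((eventually_sub_mem_Ioo hk2).and ((eventually_sub_mem_Ioo hl1).and
          (eventually_sub_mem_Ioo hl2)))).exists
      have hk := hint (X - ε) (Y - ε) k (by rw [sub_right_comm]; exact h1)
        (by rw [sub_right_comm]; exact h2)
      have hl := hint (X - ε) (Y - ε) l (by rw [sub_right_comm]; exact h3)
        (by rw [sub_right_comm]; exact h4)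
      obtain ⟨e1, e2, e3⟩ := hdisj _ _ _ _ _ _ _ hk hl
      exact Prod.ext e1 (Prod.ext e2 e3)
  have hac : 0 < a * c := mul_pos ha hc
  have hlac : 0 < lam * (a * c) := mul_pos hlam hac
  have hfinite := finite_latticeHom_le (S := a * s) hac hlam
  -- The squares and the hexagon (a rectangle if s = 0) partition the plane modulo the same lattice.
  have hsum : ∀ f g : ℝ →ₗ[ℚ] ℝ, ∑ i, f (w i) * g (w i) =
      f (a * c) * g (lam * (a * c)) + f (lam * (a * s)) * g (a * s) := by
    intro f g
    rcases hs.lt_or_eq with hs | rfl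
    · have has : 0 < a * s := mul_pos ha hs
      have hlas : 0 < lam * (a * s) := mul_pos hlam has
      have := sum_box_eq_sum_box sh hfinite (fun i => (hw i).le) (fun i => (hw i).le)
        (w' := ![a * c, lam * (a * s)]) (h' := ![lam * (a * c), a * s])
        (fun i => by fin_cases i; exacts [hac.le, hlas.le])
        (fun i => by fin_cases i; exacts [hlac.le, has.le])
        hpart (hexagon_partition hac has hlas hlac) f g
      simpa using this
    · have := sum_box_eq_sum_box sh hfinite (fun i => (hw i).le) (fun i => (hw i).le)
        (w' := fun _ : Unit => a * c) (h' := fun _ : Unit => lam * (a * c))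
        (fun _ => hac.le) (fun _ => hlac.le) hpart (a' := fun _ => 0) (b' := fun _ => 0)
        (by simpa [hsh] using rectangle_partition hac hlac) f g
      simpa using this
  refine isTwoRootForm_of_form hlam hac.ne' (s := a * s) (fun f g => ?_) fun f => ?_
  · rw [← hsum f g, ← hsum g f]
    exact Finset.sum_congr rfl fun i _ => mul_comm _ _
  · rw [← hsum f f]
    exact Finset.sum_nonneg fun i _ => mul_self_nonneg _

/-! ### Periodic tilings and two-sided coverings -/

theorem latticeVec_injective {a lam : ℝ} (ha : 0 < a) (hlam : 0 < lam) {m n m' n' : ℤ}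
    (h : latticeVec a lam m n = latticeVec a lam m' n') : m = m' ∧ n = n' := by
  have h0 := congrArg (fun x : Plane => x 0) h
  have h1 := congrArg (fun x : Plane => x 1) h
  simp only [latticeVec_zero_coord, latticeVec_one_coord] at h0 h1
  exact ⟨by exact_mod_cast mul_right_cancel₀ ha.ne' h0,
    by exact_mod_cast mul_right_cancel₀ (mul_pos ha hlam).ne' h1⟩

theorem latticeVec_sub (a lam : ℝ) (m n m' n' : ℤ) :
    latticeVec a lam (m - m') (n - n') = latticeVec a lam m n - latticeVec a lam m' n' := by
  apply plane_ext <;> simp <;> ring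

theorem latticeVec_neg (a lam : ℝ) (m n : ℤ) :
    latticeVec a lam (-m) (-n) = -latticeVec a lam m n := by
  apply plane_ext <;> simp

theorem latticeVec_zero_zero (a lam : ℝ) : latticeVec a lam 0 0 = 0 := by
  apply plane_ext <;> simp

theorem latticeVec_two (lam : ℝ) (m n : ℤ) :
    latticeVec 2 lam m n = latticeVec 1 lam m n + latticeVec 1 lam m n := by
  apply plane_ext <;> simp <;> ring

theorem mem_lattice_iff {lam : ℝ} {g : Plane} :
    g ∈ lattice lam ↔ ∃ m n, g = latticeVec 1 lam m n := by
  simp [lattice, latticeVec]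

theorem IsSquareCoverMod.eq_of_equivalent {R : Plane → Plane → Prop} {Γ : Set (Set Plane)}
    (h : IsSquareCoverMod R Γ) {q q' : Set Plane} (hq : q ∈ Γ) (hq' : q' ∈ Γ) {y y' : Plane}
    (hy : y ∈ interior q) (hy' : y' ∈ interior q') (hR : R y y') : y = y' ∧ q = q' := by
  have hyy : y = y' := h.no_overlap y (interior_mono (subset_sUnion_of_mem hq) hy) y'
    (interior_mono (subset_sUnion_of_mem hq') hy') hR
  refine ⟨hyy, ?_⟩
  by_contra hne
  exact Set.disjoint_left.1 (h.disjoint_interiors hq hq' hne) hy (hyy ▸ hy')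

theorem IsPeriodicSquareTiling.isTwoRootForm {lam : ℝ} (hlam : 0 < lam) {Γ : Set (Set Plane)}
    (h : IsPeriodicSquareTiling lam Γ) : IsTwoRootForm lam := by
  have : Fintype Γ := h.finite.fintype
  refine isTwoRootForm_of_lattice_tiling (Q := fun q : Γ => (q : Set Plane))
    (fun q => h.isClosedSquare q q.2) one_pos hlam (fun x => ?_) ?_
  · obtain ⟨y, ⟨q, hq, hy⟩, g, hg, rfl⟩ := h.covers x
    obtain ⟨m, n, rfl⟩ := mem_lattice_iff.1 hg
    exact ⟨⟨q, hq⟩, -m, -n, by rwa [latticeVec_neg, sub_neg_eq_add]⟩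
  · rintro x ⟨q, hq⟩ m n ⟨q', hq'⟩ m' n' hx hx'
    obtain ⟨e1, rfl⟩ := h.eq_of_equivalent hq hq' hx hx'
      ⟨latticeVec 1 lam (m - m') (n - n'), mem_lattice_iff.2 ⟨_, _, rfl⟩, by
        rw [latticeVec_sub]; abel⟩
    exact ⟨rfl, latticeVec_injective one_pos hlam (sub_right_injective e1)⟩

theorem complexlyEquivalent_sub (lam : ℝ) (m n : ℤ) (x : Plane) :
    ComplexlyEquivalent lam x (latticeVec 2 lam m n - x) := by
  refine ⟨Equiv.pointReflection (latticeVec 1 lam m n),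
    Submonoid.subset_closure ⟨_, mem_lattice_iff.2 ⟨m, n, rfl⟩, rfl⟩, ?_⟩
  rw [Equiv.pointReflection_apply, latticeVec_two, vsub_eq_sub, vadd_eq_add]
  abel

theorem ComplexlyEquivalent.trans {lam : ℝ} {x y z : Plane} (h : ComplexlyEquivalent lam x y)
    (h' : ComplexlyEquivalent lam y z) : ComplexlyEquivalent lam x z := by
  obtain ⟨σ, hσ, rfl⟩ := h
  obtain ⟨τ, hτ, rfl⟩ := h'
  exact ⟨τ * σ, mul_mem hτ hσ, rfl⟩

theorem complexlyEquivalent_add (lam : ℝ) (m n : ℤ) (x : Plane) :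
    ComplexlyEquivalent lam x (x + latticeVec 2 lam m n) := by
  have h := (complexlyEquivalent_sub lam 0 0 x).trans (complexlyEquivalent_sub lam m n _)
  rw [latticeVec_zero_zero] at h
  convert h using 1
  abel

/-- A reflection about g is x ↦ 2g - x, so an even number of them compose to a translation by the
doubled lattice and an odd number to a reflection. -/
theorem ComplexlyEquivalent.eq_or_eq {lam : ℝ} {x y : Plane} (h : ComplexlyEquivalent lam x y) :
    ∃ m n, x - latticeVec 2 lam m n = y ∨ x - latticeVec 2 lam m n = -y := by
  obtain ⟨σ, hσ, rfl⟩ := h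
  induction hσ using Submonoid.closure_induction_left generalizing x with
  | one => exact ⟨0, 0, Or.inl (by rw [latticeVec_zero_zero]; simp)⟩
  | mul_left τ hτ σ hσ ih =>
    obtain ⟨g, hg, rfl⟩ := hτ
    obtain ⟨k, l, rfl⟩ := mem_lattice_iff.1 hg
    obtain ⟨m, n, h | h⟩ := ih (x := x)
    · refine ⟨m + k, n + l, Or.inr ?_⟩
      rw [Equiv.Perm.mul_apply, ← h, Equiv.pointReflection_apply, vsub_eq_sub, vadd_eq_add]
      apply plane_ext <;> simp <;> ring
    · refine ⟨m - k, n - l, Or.inl ?_⟩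
      rw [Equiv.Perm.mul_apply, ← neg_neg (σ x), ← h, Equiv.pointReflection_apply, vsub_eq_sub,
        vadd_eq_add]
      apply plane_ext <;> simp <;> ring

theorem IsClosedSquare.preimage_neg {Q : Set Plane} (h : IsClosedSquare Q) :
    IsClosedSquare ((fun x => -x) ⁻¹' Q) := by
  obtain ⟨p, u, v, hu, hn, hin, rfl⟩ := h
  refine ⟨-p, -u, -v, neg_ne_zero.2 hu, by rwa [norm_neg, norm_neg], by rwa [inner_neg_neg], ?_⟩
  ext x
  simp only [mem_preimage, mem_ofPred_eq]
  refine exists_congr fun s => and_congr_right fun _ => exists_congr fun t =>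
    and_congr_right fun _ => ?_
  rw [neg_eq_iff_eq_neg]
  simp only [smul_neg, neg_add]

theorem interior_preimage_neg (Q : Set Plane) :
    interior ((fun x => -x) ⁻¹' Q) = (fun x => -x) ⁻¹' interior Q :=
  ((Homeomorph.neg Plane).preimage_interior Q).symm

/-- The condition of no overlap allows a point equivalent to itself, so such an x would be a fixed
point of a half turn. The same holds for all points of an open set around x, but a half turn fixes
only one point. -/
theorem IsTwoSidedSquareCovering.disjoint_reflection {lam : ℝ} {Γ : Set (Set Plane)}
    (h : IsTwoSidedSquareCovering lam Γ) {q q' : Set Plane} (hq : q ∈ Γ) (hq' : q' ∈ Γ)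
    {x : Plane} {m n m' n' : ℤ} (hx : x - latticeVec 2 lam m n ∈ interior q)
    (hx' : -(x - latticeVec 2 lam m' n') ∈ interior q') : False := by
  set V := latticeVec 2 lam m n with hV
  set V' := latticeVec 2 lam m' n' with hV'
  have hfix : ∀ y, y - V ∈ interior q → -(y - V') ∈ interior q' → y - V = -(y - V') := by
    intro y hy hy'
    refine (h.eq_of_equivalent hq hq' hy hy' ?_).1
    convert complexlyEquivalent_sub lam (m' - m) (n' - n) (y - V) using 1
    rw [latticeVec_sub]
    abel
  set O : Set Plane := {y | y - V ∈ interior q ∧ -(y - V') ∈ interior q'} with hO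
  have hopen : IsOpen O :=
    (isOpen_interior.preimage (continuous_id.sub continuous_const)).inter
      (isOpen_interior.preimage (continuous_id.sub continuous_const).neg)
  have hsub : O = {x} := by
    refine Set.eq_singleton_iff_unique_mem.2 ⟨⟨hx, hx'⟩, fun y hy => ?_⟩
    have e1 := hfix y hy.1 hy.2
    have e2 := hfix x hx hx'
    have : (2 : ℝ) • y = (2 : ℝ) • x := by
      rw [two_smul, two_smul]
      have a1 : y + y = V + V' := by rw [sub_eq_iff_eq_add] at e1; nth_rewrite 1 [e1]; abel
      have a2 : x + x = V + V' := by rw [sub_eq_iff_eq_add] at e2; nth_rewrite 1 [e2]; abel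
      rw [a1, a2]
    exact smul_right_injective _ two_ne_zero this
  rw [hsub] at hopen
  exact not_isOpen_singleton x hopen

theorem IsTwoSidedSquareCovering.isTwoRootForm {lam : ℝ} (hlam : 0 < lam) {Γ : Set (Set Plane)}
    (h : IsTwoSidedSquareCovering lam Γ) : IsTwoRootForm lam := by
  have : Fintype Γ := h.finite.fintype
  -- The Boolean selects a square or its image under x ↦ -x; a = 2 because translations arising from
  -- reflections lie in the doubled lattice.
  refine isTwoRootForm_of_lattice_tiling (ι := Γ × Bool) (a := 2)
    (Q := fun k => cond k.2 ((fun x => -x) ⁻¹' (k.1 : Set Plane)) k.1) ?_ two_pos hlam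
    (fun x => ?_) ?_
  · rintro ⟨⟨q, hq⟩, _ | _⟩
    · exact h.isClosedSquare q hq
    · exact (h.isClosedSquare q hq).preimage_neg
  · obtain ⟨y, ⟨q, hq, hy⟩, hxy⟩ := h.covers x
    obtain ⟨m, n, e | e⟩ := hxy.eq_or_eq
    · exact ⟨(⟨q, hq⟩, false), m, n, by simpa [e] using hy⟩
    · exact ⟨(⟨q, hq⟩, true), m, n, by simpa [e] using hy⟩
  · rintro x ⟨⟨q, hq⟩, b⟩ m n ⟨⟨q', hq'⟩, b'⟩ m' n' hx hx'
    cases b <;> cases b' <;> simp only [cond_true, cond_false, interior_preimage_neg, mem_preimage] at hx hx'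
    · obtain ⟨e1, rfl⟩ := h.eq_of_equivalent hq hq' hx hx' (by
        convert complexlyEquivalent_add lam (m - m') (n - n') _ using 1
        rw [latticeVec_sub]; abel)
      exact ⟨rfl, latticeVec_injective two_pos hlam (sub_right_injective e1)⟩
    · exact (h.disjoint_reflection hq hq' hx hx').elim
    · exact (h.disjoint_reflection hq' hq hx' hx).elim
    · obtain ⟨e1, rfl⟩ := h.eq_of_equivalent hq hq' hx hx' (by
        convert complexlyEquivalent_add lam (m' - m) (n' - n) _ using 1
        rw [latticeVec_sub]; abel)
      exact ⟨rfl, latticeVec_injective two_pos hlam (sub_right_injective (neg_injective e1))⟩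

end SquareTiling

theorem mainTheorem1 (lam : ℝ) (hlam : 0 < lam) :
    ((∃ Γ : Set (Set SquareTiling.Plane), SquareTiling.IsPeriodicSquareTiling lam Γ) →
      ∃ p q r : ℚ, p ≥ q ∧ q ≥ r ∧ r ≥ 0 ∧
        (lam = (p : ℝ) + √((q : ℝ) ^ 2 - (r : ℝ) ^ 2) ∨
          lam = (p : ℝ) - √((q : ℝ) ^ 2 - (r : ℝ) ^ 2))) ∧
    ((∃ Γ : Set (Set SquareTiling.Plane), SquareTiling.IsTwoSidedSquareCovering lam Γ) →
      ∃ p q r : ℚ, p ≥ q ∧ q ≥ r ∧ r ≥ 0 ∧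
        (lam = (p : ℝ) + √((q : ℝ) ^ 2 - (r : ℝ) ^ 2) ∨
          lam = (p : ℝ) - √((q : ℝ) ^ 2 - (r : ℝ) ^ 2))) :=
  ⟨fun ⟨_, h⟩ => SquareTiling.IsPeriodicSquareTiling.isTwoRootForm hlam h,
    fun ⟨_, h⟩ => SquareTiling.IsTwoSidedSquareCovering.isTwoRootForm hlam h⟩
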